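/- Let $\Sigma=\{0,1\}$ and let $\mu$ be the Lebesgue (uniform product) measure on the Cantor space $\Sigma^{\mathbb N}$. For a language $L\subseteq\Sigma^*$ let $[L]\subseteq\Sigma^{\mathbb N}$ be the set of all infinite sequences that have a prefix in $L$. The convolution of two words $x,y$ is the word over $(\Sigma\cup\{\#\})^2$ obtained by writing $x$ above $y$ and filling up the shorter one at its end with $\#$ to the length of the longer one; a relation $R\subseteq\Sigma^*\times\Sigma^*$ is automatic if some deterministic finite automaton accepts the convolution of $x$ and $y$ exactly when $(x,y)\in R$. An automatic family is a family $\mathcal U=(U_i)_{i\in I}$ of languages $U_i\subseteq\Sigma^*$, indexed by a regular language $I\subseteq\Sigma^*$, such that the relation $\{(x,i) : i\in I,\ x\in U_i\}$ is automatic. It is an automatic randomness test (ART) if $\liminf_{i\in I}\mu[U_i]=0$, that is, if for every $\varepsilon>0$ there are infinitely many $i\in I$ with $\mu[U_i]<\varepsilon$. An infinite sequence $X\in\Sigma^{\mathbb N}$ is covered by $\mathcal U$ if $X\in\bigcap_{i\in I}[U_i]$, it is automatic random (AR) if it is covered by no ART, and it is disjunctive if every finite word $w\in\Sigma^*$ occurs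 in $X$ as a contiguous subword. **Theorem 9 (Combinatorial characterization of AR).** An infinite sequence $X\in\Sigma^{\mathbb N}$ is automatic random if and only if it is disjunctive. -/

import Mathlib

open MeasureTheory Filter

noncomputable section

namespace AutomaticRandomness

/-- Words over the binary alphabet `{0, 1}`. -/
abbrev Word : Type := List Bool

/-- Infinite binary sequences, i.e. points of the Cantor space. Positions are counted from `0`. -/
abbrev Seq : Type := ℕ → Bool

/-- The word of length `l` that occurs in `X` from position `n` on. -/
def factor (X : Seq) (n l : ℕ) : Word := (List.range l).map fun j => X (n + j)

/-- `w` is a prefix of the infinite sequence `X`. -/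
def IsPrefixOf (w : Word) (X : Seq) : Prop := factor X 0 w.length = w

/-- The class `[L]` of all infinite sequences that extend some word of the language `L`. -/
def extensions (L : Language Bool) : Set Seq := {X | ∃ w ∈ L, IsPrefixOf w X}

/-- The Lebesgue measure on the Cantor space: the infinite product of the uniform probability
measure on `{0, 1}`. -/
def cantorMeasure : Measure Seq :=
  Measure.infinitePi fun _ : ℕ => (PMF.uniformOfFintype Bool).toMeasure

/-- The convolution of two words: they are written above each other, and the shorter one is filled
up at its end with the blank symbol `#`, here `none`, to the length of the longer one. -/
def convolution (x y : Word) : List (Option Bool × Option Bool) :=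
  (List.range (max x.length y.length)).map fun n => (x[n]?, y[n]?)

/-- A binary relation on words is automatic if some deterministic finite automaton over the
alphabet of pairs accepts the convolution of `x` and `y` exactly when `x` and `y` are related. -/
def IsAutomaticRel (R : Word → Word → Prop) : Prop :=
  ∃ (σ : Type) (_ : Fintype σ) (M : DFA (Option Bool × Option Bool) σ),
    ∀ x y : Word, convolution x y ∈ M.accepts ↔ R x y

/-- An automatic family: languages `U i`, indexed by the words `i` of a regular language `I`, such
that the relation `x ∈ U i` between words `x` and indices `i` is automatic. -/
structure AutomaticFamily where
  /-- the index set -/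
  I : Language Bool
  /-- the members of the family -/
  U : {i : Word // i ∈ I} → Language Bool
  /-- the index set is a regular language -/
  regular : I.IsRegular
  /-- the relation of membership is automatic -/
  automatic : IsAutomaticRel fun x i => ∃ h : i ∈ I, x ∈ U ⟨i, h⟩

/-- An automatic family is an automatic randomness test (ART) if `liminf μ[U i] = 0`. The limit
inferior is taken along the cofinite filter of the (countable) index set, i.e. as `i` runs through
the index set in any enumeration without repetitions. -/
def AutomaticFamily.IsART (𝒰 : AutomaticFamily) : Prop :=
  liminf (fun i => cantorMeasure (extensions (𝒰.U i))) cofinite = 0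

/-- The covering region of a family: the intersection of all the classes `[U i]`. -/
def AutomaticFamily.coveringRegion (𝒰 : AutomaticFamily) : Set Seq :=
  ⋂ i, extensions (𝒰.U i)

/-- A sequence is automatic random (AR) if it is covered by no ART. -/
def IsAutomaticRandom (X : Seq) : Prop :=
  ∀ 𝒰 : AutomaticFamily, 𝒰.IsART → X ∉ 𝒰.coveringRegion

/-- A sequence is disjunctive if every finite word occurs in it as a (contiguous) subword. -/
def IsDisjunctive (X : Seq) : Prop :=
  ∀ w : Word, ∃ n : ℕ, factor X n w.length = w

end AutomaticRandomness

end

namespace AutomaticRandomness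

open scoped ENNReal

/-! If `X` misses a word `w`, then `w` is nonempty and `X` is covered by the family whose member at
`i` consists of the words avoiding `w` of length at least `|i|`. Avoiding `w` on disjoint blocks
makes the measures decay geometrically in `|i|`, so this is a test (`avoidingFamily_isART`).

Conversely, let a test cover a disjunctive `X`. Reading sequence and index in parallel is a
finite-state process (`coverStep`), so a covering set that is nonempty when the index ends has
measure at least some `δ > 0`. Choose an index of measure far below `δ`, long enough to be pumped as
`a b v`. The union, over all states reachable after `a`, of what `v` can still cover has measure
below `δ`, so one word `w` of length `|v|` escapes from all these states (`exists_escape`). Pumping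
`b` preserves the reachable states, so the same `w` escapes the index `a b^k v` when it stands at
position `|a| + k|b|`. Disjunctivity provides such a `k`
(`IsDisjunctive.exists_factor_in_progression`), a contradiction. -/

/-! ### Factors and shifts of sequences -/

/-- Prepend a letter to an infinite sequence. -/
def cons (x : Bool) (Z : Seq) : Seq
  | 0 => x
  | n + 1 => Z n

/-- Drop the first `n` letters of an infinite sequence. -/
def shift (n : ℕ) (Z : Seq) : Seq := fun m => Z (n + m)

@[simp] theorem cons_zero (x : Bool) (Z : Seq) : cons x Z 0 = x := rfl

@[simp] theorem cons_succ (x : Bool) (Z : Seq) (n : ℕ) : cons x Z (n + 1) = Z n := rfl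

@[simp] theorem shift_zero (Z : Seq) : shift 0 Z = Z := by
  funext m; simp [shift]

theorem cons_head_tail (Z : Seq) : cons (Z 0) (shift 1 Z) = Z := by
  funext n
  cases n with
  | zero => rfl
  | succ n => simp [shift, Nat.add_comm]

theorem shift_succ_cons (n : ℕ) (x : Bool) (Z : Seq) : shift (n + 1) (cons x Z) = shift n Z := by
  funext m
  simp [shift, Nat.add_right_comm n 1 m]

theorem shift_shift (m n : ℕ) (Z : Seq) : shift m (shift n Z) = shift (n + m) Z := by
  funext k; simp [shift, Nat.add_assoc]

@[simp] theorem length_factor (Z : Seq) (n l : ℕ) : (factor Z n l).length = l := by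
  simp [factor]

@[simp] theorem factor_zero (Z : Seq) (n : ℕ) : factor Z n 0 = [] := rfl

theorem factor_eq_factor_shift (Z : Seq) (n l : ℕ) : factor Z n l = factor (shift n Z) 0 l := by
  simp [factor, shift]

theorem factor_cons_succ (x : Bool) (Z : Seq) (l : ℕ) :
    factor (cons x Z) 0 (l + 1) = x :: factor Z 0 l := by
  simp [factor, List.range_succ_eq_map, Function.comp_def]

theorem factor_add (Z : Seq) (n k l : ℕ) :
    factor Z n (k + l) = factor Z n k ++ factor Z (n + k) l := by
  simp [factor, List.range_add, Function.comp_def, Nat.add_assoc]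

/-! ### The measure on the Cantor space -/

instance : IsProbabilityMeasure cantorMeasure := by
  unfold cantorMeasure; infer_instance

theorem measurable_cons (x : Bool) : Measurable (cons x) := by
  refine measurable_pi_lambda _ fun n => ?_
  cases n with
  | zero => exact measurable_const
  | succ n => exact measurable_pi_apply n

theorem measurableSet_factor (p : Word → Prop) (l : ℕ) :
    MeasurableSet {Z : Seq | p (factor Z 0 l)} := by
  have h : {Z : Seq | p (factor Z 0 l)} =
      (fun (Z : Seq) (j : Fin l) => Z j) ⁻¹' {y | p (List.ofFn y)} := by
    ext Z
    have : factor Z 0 l = List.ofFn fun j : Fin l => Z j := by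
      apply List.ext_getElem <;> simp [factor]
    simp [this]
  rw [h]
  exact (measurable_pi_lambda _ fun j => measurable_pi_apply _) .of_discrete

theorem measure_uniform_bool (A : Set Bool) :
    (PMF.uniformOfFintype Bool).toMeasure A =
      2⁻¹ * (A.indicator 1 false + A.indicator 1 true) := by
  classical
  rw [PMF.toMeasure_apply_fintype]
  by_cases h₁ : false ∈ A <;> by_cases h₂ : true ∈ A <;> simp [h₁, h₂, mul_add]

theorem map_cons_pi_range (x : Bool) (n : ℕ) (t : ℕ → Set Bool) :
    cantorMeasure.map (cons x) (Set.pi (Finset.range (n + 1)) t) =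
      (t 0).indicator 1 x *
        ∏ i ∈ Finset.range n, (PMF.uniformOfFintype Bool).toMeasure (t (i + 1)) := by
  rw [Measure.map_apply (measurable_cons x)
    (.pi (Finset.countable_toSet _) fun _ _ => .of_discrete)]
  by_cases hx : x ∈ t 0
  · have : cons x ⁻¹' Set.pi (Finset.range (n + 1)) t =
        Set.pi (Finset.range n) fun i => t (i + 1) := by
      ext Z
      simp only [Set.mem_preimage, Set.mem_pi, Finset.coe_range, Set.mem_Iio]
      refine ⟨fun h i hi => h (i + 1) (by lia), fun h i hi => ?_⟩
      cases i with
      | zero => exact hx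
      | succ i => exact h i (by lia)
    rw [this, cantorMeasure, Measure.infinitePi_pi _ fun _ _ => .of_discrete]
    simp [hx]
  · have : cons x ⁻¹' Set.pi (Finset.range (n + 1)) t = ∅ := by
      ext Z
      simp only [Set.mem_preimage, Set.mem_pi, Finset.coe_range, Set.mem_Iio,
        Set.mem_empty_iff_false, iff_false]
      exact fun h => hx (h 0 (by lia))
    rw [this]
    simp [hx]

/-- Self-similarity of the measure, the source of all later estimates by induction on letters. A
product measure is determined by boxes. -/
theorem cantorMeasure_eq_average :
    (2⁻¹ : ℝ≥0∞) • (cantorMeasure.map (cons false) + cantorMeasure.map (cons true)) =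
      cantorMeasure := by
  classical
  refine Measure.eq_infinitePi _ fun s t _ => ?_
  obtain ⟨n, hn⟩ : ∃ n, s ⊆ Finset.range (n + 1) :=
    ⟨s.sup id, fun i hi => Finset.mem_range.2 (Nat.lt_succ_of_le (Finset.le_sup (f := id) hi))⟩
  -- Padding the box to an initial segment makes coordinate `0` always present, so that `cons`
  -- merely shifts the others.
  let t' : ℕ → Set Bool := fun i => if i ∈ s then t i else Set.univ
  have h₁ : Set.pi s t = Set.pi (Finset.range (n + 1)) t' := by
    ext Z
    simp only [Set.mem_pi, Finset.mem_coe, t']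
    refine ⟨fun h i _ => ?_, fun h i hi => by simpa [hi] using h i (hn hi)⟩
    split_ifs with hi
    · exact h i hi
    · trivial
  have h₂ : ∏ i ∈ s, (PMF.uniformOfFintype Bool).toMeasure (t i) =
      ∏ i ∈ Finset.range (n + 1), (PMF.uniformOfFintype Bool).toMeasure (t' i) := by
    rw [← Finset.prod_subset hn]
    · exact Finset.prod_congr rfl fun i hi => by simp [t', hi]
    · intro i _ hi; simp only [t', if_neg hi, measure_univ]
  rw [h₁, h₂, Finset.prod_range_succ', Measure.smul_apply, Measure.add_apply, map_cons_pi_range,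
    map_cons_pi_range, measure_uniform_bool (t' 0), smul_eq_mul]
  ring

theorem cantorMeasure_eq {A : Set Seq} (hA : MeasurableSet A) :
    cantorMeasure A =
      2⁻¹ * (cantorMeasure (cons false ⁻¹' A) + cantorMeasure (cons true ⁻¹' A)) := by
  conv_lhs => rw [← cantorMeasure_eq_average]
  rw [Measure.smul_apply, Measure.add_apply, Measure.map_apply (measurable_cons _) hA,
    Measure.map_apply (measurable_cons _) hA, smul_eq_mul]

theorem measure_preimage_cons_le {A : Set Seq} (hA : MeasurableSet A) (x : Bool) :
    cantorMeasure (cons x ⁻¹' A) ≤ 2 * cantorMeasure A := by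
  rw [cantorMeasure_eq hA, ← mul_assoc, ENNReal.mul_inv_cancel two_ne_zero ENNReal.ofNat_ne_top,
    one_mul]
  cases x
  · exact le_self_add
  · exact le_add_self

theorem exists_measure_preimage_cons_le {A : Set Seq} (hA : MeasurableSet A) :
    ∃ x, cantorMeasure (cons x ⁻¹' A) ≤ cantorMeasure A := by
  by_contra! h
  have h' := ENNReal.add_lt_add (h false) (h true)
  have := (ENNReal.mul_lt_mul_iff_right (a := 2⁻¹) (by simp) (by simp)).2 h'
  rw [← cantorMeasure_eq hA, ← two_mul, ← mul_assoc,
    ENNReal.inv_mul_cancel two_ne_zero ENNReal.ofNat_ne_top, one_mul] at this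
  exact this.false

theorem cylinder_measure_pos (w : Word) : 0 < cantorMeasure {Z | IsPrefixOf w Z} := by
  induction w with
  | nil => simp [IsPrefixOf]
  | cons x w ih =>
    have h := measure_preimage_cons_le
      (measurableSet_factor (fun u => u = x :: w) (x :: w).length) x
    have he : cons x ⁻¹' {Z | factor Z 0 (x :: w).length = x :: w} = {Z | IsPrefixOf w Z} := by
      ext Z
      simp [IsPrefixOf, factor_cons_succ]
    rw [he] at h
    by_contra! h0
    rw [nonpos_iff_eq_zero] at h0
    simp only [IsPrefixOf] at h0
    rw [h0, mul_zero] at h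
    exact ih.not_ge h

/-! ### Occurrences in disjunctive sequences -/

/-- One occurrence of a long word made of padded copies of `w` suffices: their spacing `B` is `1`
modulo `m`, so the copies start in every residue class. -/
theorem IsDisjunctive.exists_factor_in_progression {X : Seq} (hX : IsDisjunctive X) (w : Word)
    (r m : ℕ) (hm : 0 < m) : ∃ k, factor X (r + k * m) w.length = w := by
  set B := w.length * m + 1 with hB
  set L := (r + m) * B with hL
  have hwB : w.length < B := Nat.lt_succ_of_le (Nat.le_mul_of_pos_right _ hm)
  obtain ⟨n, hn⟩ := hX ((List.range L).map fun s => w.getD (s % B) false)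
  have hn' : ∀ s < L, X (n + s) = w.getD (s % B) false := by
    intro s hs
    simp only [List.length_map, List.length_range, factor] at hn
    exact List.map_inj_left.1 hn s (List.mem_range.2 hs)
  -- Since `n * (m - 1)` is `-n` modulo `m`, the `j`-th copy starts at a position congruent to `r`;
  -- the summand `r` keeps that position from falling below `r`.
  set j := r + n * (m - 1) % m with hj
  have hjlt : j < r + m := Nat.add_lt_add_left (Nat.mod_lt _ hm) _
  have hpos : n + j * B = r + (n - n * (m - 1) / m + j * w.length) * m := by
    obtain ⟨m, rfl⟩ : ∃ m', m = m' + 1 := ⟨m - 1, by lia⟩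
    simp only [Nat.add_sub_cancel] at hj ⊢
    have h₁ := Nat.mod_add_div (n * m) (m + 1)
    have h₂ : n * m / (m + 1) ≤ n :=
      Nat.div_le_of_le_mul (by rw [Nat.mul_comm]; exact Nat.mul_le_mul_right _ (Nat.le_succ m))
    obtain ⟨e, he⟩ := Nat.exists_eq_add_of_le h₂
    have h₃ : n - n * m / (m + 1) = e := by lia
    rw [h₃, hB]
    have h₄ : n * (m + 1) = n * m + n := by ring
    have h₅ : n * (m + 1) = (m + 1) * (n * m / (m + 1)) + e * (m + 1) := by
      conv_lhs => rw [he]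
      ring
    have h₆ : n + j = r + e * (m + 1) := by lia
    calc n + j * (w.length * (m + 1) + 1) = n + j + j * w.length * (m + 1) := by ring
      _ = _ := by rw [h₆]; ring
  refine ⟨n - n * (m - 1) / m + j * w.length, ?_⟩
  rw [← hpos]
  refine List.ext_getElem (by simp) fun t h₁ h₂ => ?_
  have ht : j * B + t < L := by
    calc j * B + t < j * B + B := by lia
      _ = (j + 1) * B := by ring
      _ ≤ L := Nat.mul_le_mul_right _ hjlt
  have := hn' (j * B + t) ht
  rw [Nat.mul_comm j, Nat.mul_add_mod, Nat.mod_eq_of_lt (h₂.trans hwB)] at this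
  simp only [factor, List.getElem_map, List.getElem_range, Nat.add_assoc, Nat.mul_comm j]
  rw [this, List.getD_eq_getElem _ _ h₂]

/-! ### Convolutions -/

theorem convolution_cons_cons (x b : Bool) (u v : Word) :
    convolution (x :: u) (b :: v) = (some x, some b) :: convolution u v := by
  simp [convolution, List.range_succ_eq_map, Function.comp_def]

theorem convolution_nil_cons (b : Bool) (v : Word) :
    convolution [] (b :: v) = (none, some b) :: convolution [] v := by
  simp [convolution, List.range_succ_eq_map, Function.comp_def]

/-! ### Covering as a finite-state process -/

section Covering

variable {σ : Type*} (M : DFA (Option Bool × Option Bool) σ)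

/-- The state after reading some letters of a sequence and of an index: the state of `M` on the
prefix read so far, together with the states of `M` on all shorter, padded prefixes. -/
def coverStep (s : σ × Set σ) (x b : Bool) : σ × Set σ :=
  (M.step s.1 (some x, some b), (fun p => M.step p (none, some b)) '' insert s.1 s.2)

/-- The sequences that are covered from the state `s` on when `v` remains of the index. -/
def coverSet (s : σ × Set σ) (v : Word) : Set Seq :=
  {Z | (∃ p ∈ s.2, M.evalFrom p (convolution [] v) ∈ M.accept) ∨
    ∃ l, M.evalFrom s.1 (convolution (factor Z 0 l) v) ∈ M.accept}

/-- The prefix of length `0` ends here and is padded from now on, which is why `coverStep` inserts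
the current state among the padded ones. -/
theorem cons_mem_coverSet (s : σ × Set σ) (x b : Bool) (Z : Seq) (v : Word) :
    cons x Z ∈ coverSet M s (b :: v) ↔ Z ∈ coverSet M (coverStep M s x b) v := by
  simp only [coverSet, coverStep, Set.mem_ofPred_eq, convolution_nil_cons, DFA.evalFrom_cons,
    Set.exists_mem_image, Set.exists_mem_insert]
  rw [← Nat.or_exists_add_one]
  simp only [factor_zero, factor_cons_succ, convolution_nil_cons, convolution_cons_cons,
    DFA.evalFrom_cons, ← or_assoc]
  rw [or_comm (a := ∃ p ∈ s.2, _)]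

theorem preimage_cons_coverSet (s : σ × Set σ) (x b : Bool) (v : Word) :
    cons x ⁻¹' coverSet M s (b :: v) = coverSet M (coverStep M s x b) v :=
  Set.ext fun Z => cons_mem_coverSet M s x b Z v

theorem measurableSet_coverSet (s : σ × Set σ) (v : Word) : MeasurableSet (coverSet M s v) := by
  rw [coverSet, Set.ofPred_or]
  refine (MeasurableSet.const _).union ?_
  rw [Set.ofPred_exists]
  exact .iUnion fun l => measurableSet_factor
    (fun u => M.evalFrom s.1 (convolution u v) ∈ M.accept) l

theorem measure_coverSet_pos {s : σ × Set σ} {v : Word} (h : (coverSet M s v).Nonempty) :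
    0 < cantorMeasure (coverSet M s v) := by
  obtain ⟨Z, h | ⟨l, hl⟩⟩ := h
  · have : coverSet M s v = Set.univ := Set.eq_univ_of_forall fun _ => Or.inl h
    simp [this]
  · refine (cylinder_measure_pos (factor Z 0 l)).trans_le (measure_mono fun Y hY => ?_)
    rw [Set.mem_ofPred_eq, IsPrefixOf, length_factor] at hY
    exact Or.inr ⟨l, by rwa [hY]⟩

/-- A nonempty covering set contains a cylinder, and with the index used up only finitely many such
sets remain. -/
theorem exists_measure_coverSet_lower_bound [Finite σ] :
    ∃ δ : ℝ≥0∞, 0 < δ ∧ ∀ s, (coverSet M s []).Nonempty →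
      δ ≤ cantorMeasure (coverSet M s []) := by
  classical
  have := Fintype.ofFinite (σ × Set σ)
  refine ⟨Finset.univ.inf fun s =>
    if (coverSet M s []).Nonempty then cantorMeasure (coverSet M s []) else ⊤, ?_, ?_⟩
  · rw [Finset.lt_inf_iff ENNReal.zero_lt_top]
    intro s _
    split_ifs with h
    · exact measure_coverSet_pos M h
    · exact ENNReal.zero_lt_top
  · intro s hs
    refine (Finset.inf_le (Finset.mem_univ s)).trans ?_
    rw [if_pos hs]

/-- A small enough union of covering sets is escaped by a single word. -/
theorem exists_escape [Finite σ] {δ : ℝ≥0∞}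
    (hδ : ∀ s, (coverSet M s []).Nonempty → δ ≤ cantorMeasure (coverSet M s []))
    (v : Word) (S : Set (σ × Set σ))
    (hS : cantorMeasure (⋃ s ∈ S, coverSet M s v) < δ) :
    ∃ w : Word, w.length = v.length ∧
      -- Each letter is chosen so that the measure of the union does not grow; at the end it is
      -- below `δ`, so every set in the union is empty.
      ∀ s ∈ S, ∀ Z, factor Z 0 v.length = w → Z ∉ coverSet M s v := by
  induction v generalizing S with
  | nil =>
    refine ⟨[], rfl, fun s hs Z _ hZ => (hS.trans_le (hδ s ⟨Z, hZ⟩)).not_ge ?_⟩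
    exact measure_mono (Set.subset_biUnion_of_mem (u := fun s => coverSet M s []) hs)
  | cons b v ih =>
    obtain ⟨x, hx⟩ := exists_measure_preimage_cons_le
      (A := ⋃ s ∈ S, coverSet M s (b :: v))
      (.biUnion S.to_countable fun s _ => measurableSet_coverSet M s _)
    have hS' : cantorMeasure (⋃ s ∈ (fun s => coverStep M s x b) '' S, coverSet M s v) < δ := by
      refine lt_of_le_of_lt (le_of_eq_of_le ?_ hx) hS
      simp only [Set.biUnion_image, Set.preimage_iUnion, preimage_cons_coverSet]
    obtain ⟨w, hw, h⟩ := ih _ hS'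
    refine ⟨x :: w, by simp [hw], fun s hs Z hZ => ?_⟩
    rw [← cons_head_tail Z, List.length_cons, factor_cons_succ, List.cons.injEq] at hZ
    rw [← cons_head_tail Z, hZ.1, cons_mem_coverSet]
    exact h _ (Set.mem_image_of_mem _ hs) _ hZ.2

/-- The automaton on indices that tracks all states reachable by reading some sequence. -/
def reachDFA (start : σ × Set σ) : DFA Bool (Set (σ × Set σ)) where
  step S b := {s' | ∃ s ∈ S, ∃ x, coverStep M s x b = s'}
  start := {start}
  -- Only the runs of this automaton matter, not its language.
  accept := ∅

/-- Conditioning on one letter at most doubles a measure. -/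
theorem exists_measure_le_of_mem_reach (start : σ × Set σ) (a v : Word) (S : Set (σ × Set σ)) :
    ∀ s' ∈ (reachDFA M start).evalFrom S a, ∃ s ∈ S,
      cantorMeasure (coverSet M s' v) ≤ 2 ^ a.length * cantorMeasure (coverSet M s (a ++ v)) := by
  induction a generalizing S with
  | nil => exact fun s' hs' => ⟨s', hs', by simp⟩
  | cons b a ih =>
    intro s' hs'
    rw [DFA.evalFrom_cons] at hs'
    obtain ⟨_, ⟨s, hs, x, rfl⟩, h⟩ := ih _ s' hs'
    refine ⟨s, hs, h.trans ?_⟩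
    rw [List.length_cons, pow_succ, mul_assoc, ← preimage_cons_coverSet]
    exact mul_le_mul_right (measure_preimage_cons_le (measurableSet_coverSet M _ _) x) _

theorem exists_mem_reach_shift (start : σ × Set σ) (a v : Word) (S : Set (σ × Set σ)) (Z : Seq) :
    ∀ s ∈ S, Z ∈ coverSet M s (a ++ v) →
      ∃ s' ∈ (reachDFA M start).evalFrom S a, shift a.length Z ∈ coverSet M s' v := by
  induction a generalizing S Z with
  | nil => exact fun s hs hZ => ⟨s, hs, by simpa using hZ⟩
  | cons b a ih =>
    intro s hs hZ
    rw [← cons_head_tail Z, List.cons_append, cons_mem_coverSet] at hZ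
    obtain ⟨s', hs', h⟩ := ih ((reachDFA M start).step S b) _ _ ⟨s, hs, Z 0, rfl⟩ hZ
    refine ⟨s', by rwa [DFA.evalFrom_cons], ?_⟩
    rwa [shift_shift, Nat.add_comm] at h

end Covering

/-! ### Disjunctive sequences are automatic random -/

theorem coverSet_start {σ : Type*} (𝒰 : AutomaticFamily)
    (M : DFA (Option Bool × Option Bool) σ)
    (hM : ∀ x y : Word, convolution x y ∈ M.accepts ↔ ∃ h : y ∈ 𝒰.I, x ∈ 𝒰.U ⟨y, h⟩)
    (i : {i : Word // i ∈ 𝒰.I}) :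
    coverSet M (M.start, ∅) i = extensions (𝒰.U i) := by
  ext Z
  simp only [coverSet, Set.mem_empty_iff_false, false_and, exists_false, false_or,
    Set.mem_ofPred_eq, extensions, IsPrefixOf]
  refine ⟨fun ⟨l, hl⟩ => ?_, fun ⟨w, hw, h⟩ => ⟨w.length, ?_⟩⟩
  · obtain ⟨_, h⟩ := (hM _ _).1 hl
    exact ⟨_, h, by rw [length_factor]⟩
  · rw [h]
    exact (hM _ _).2 ⟨i.2, hw⟩

theorem mem_kstar_singleton_iff {α : Type*} {b z : List α} :
    z ∈ KStar.kstar ({b} : Language α) ↔ ∃ k, z = (List.replicate k b).flatten := by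
  rw [Language.mem_kstar]
  constructor
  · rintro ⟨L, rfl, hL⟩
    exact ⟨L.length, by rw [← List.eq_replicate_of_mem hL]⟩
  · rintro ⟨k, rfl⟩
    exact ⟨_, rfl, fun y hy => List.eq_of_mem_replicate hy⟩

theorem tendsto_length_cofinite (I : Language Bool) :
    Tendsto (fun i : {i : Word // i ∈ I} => i.1.length) cofinite atTop := by
  refine tendsto_atTop.2 fun n => ?_
  rw [eventually_cofinite]
  refine ((List.finite_length_lt Bool n).preimage Subtype.val_injective.injOn).subset ?_
  intro i hi
  simpa using hi

theorem IsDisjunctive.isAutomaticRandom {X : Seq} (hX : IsDisjunctive X) :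
    IsAutomaticRandom X := by
  classical
  intro 𝒰 hART hcov
  obtain ⟨σ, _, M, hM⟩ := 𝒰.automatic
  obtain ⟨τ, _, N, hN⟩ := 𝒰.regular
  obtain ⟨δ, hδ, hlow⟩ := exists_measure_coverSet_lower_bound M
  let R := reachDFA M (M.start, ∅)
  -- A loop of the product keeps the reachable states and also membership of the pumped word in the
  -- index set.
  let K : DFA Bool (Set (σ × Set σ) × τ) := R.inter N
  have hK : ∀ x (S : Set (σ × Set σ)) (t : τ),
      K.evalFrom (S, t) x = (R.evalFrom S x, N.evalFrom t x) := by
    intro x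
    induction x with
    | nil => intro S t; rfl
    | cons b x ih => intro S t; exact ih _ _
  have := Fintype.ofFinite (Set (σ × Set σ) × τ)
  set T := Fintype.card (Set (σ × Set σ) × τ)
  -- The first factor bounds the number of reachable states, the second the growth of measure along
  -- `a ++ b`. Dividing by `C + 1` below makes the divisor visibly nonzero.
  set C : ℝ≥0∞ := Nat.card (σ × Set σ) * 2 ^ T with hC
  have hCtop : C ≠ ⊤ := by finiteness
  have hδtop : 0 < δ / (C + 1) := ENNReal.div_pos hδ.ne' (by finiteness)
  obtain ⟨i, hi, hlen⟩ := ((frequently_lt_of_liminf_lt (by isBoundedDefault)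
    (lt_of_eq_of_lt hART hδtop)).and_eventually
      ((tendsto_length_cofinite 𝒰.I).eventually_ge_atTop T)).exists
  obtain ⟨⟨S, q⟩, a, b, v, hi', hab, hb, h₁, h₂, h₃⟩ :=
    K.evalFrom_split (s := ({(M.start, ∅)}, N.start)) hlen rfl
  rw [hK, Prod.mk.injEq] at h₁ h₂
  have hsmall : cantorMeasure (⋃ s ∈ S, coverSet M s v) < δ := by
    have hle : ∀ s ∈ S, cantorMeasure (coverSet M s v) ≤
        2 ^ T * cantorMeasure (extensions (𝒰.U i)) := by
      intro s hs
      rw [← h₂.1, ← h₁.1, ← DFA.evalFrom_of_append] at hs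
      obtain ⟨_, rfl, h⟩ := exists_measure_le_of_mem_reach M _ (a ++ b) v _ s hs
      rw [← hi', coverSet_start 𝒰 M hM] at h
      refine h.trans ?_
      gcongr
      · exact one_le_two
      · simpa using hab
    have := Fintype.ofFinite (σ × Set σ)
    calc cantorMeasure (⋃ s ∈ S, coverSet M s v)
        = cantorMeasure (⋃ s ∈ S.toFinset, coverSet M s v) := by simp
      _ ≤ ∑ s ∈ S.toFinset, cantorMeasure (coverSet M s v) := measure_biUnion_finset_le _ _
      _ ≤ ∑ s ∈ S.toFinset, 2 ^ T * cantorMeasure (extensions (𝒰.U i)) :=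
          Finset.sum_le_sum fun s hs => hle s (by simpa using hs)
      _ ≤ Nat.card (σ × Set σ) * (2 ^ T * cantorMeasure (extensions (𝒰.U i))) := by
          rw [Finset.sum_const, nsmul_eq_mul, Nat.card_eq_fintype_card]
          gcongr
          exact Finset.card_le_univ _
      _ = C * cantorMeasure (extensions (𝒰.U i)) := by rw [hC, mul_assoc]
      _ ≤ (C + 1) * cantorMeasure (extensions (𝒰.U i)) := by gcongr; exact le_self_add
      _ < δ := by
          rw [mul_comm]
          exact (ENNReal.lt_div_iff_mul_lt (.inl (by simp)) (.inl (by finiteness))).1 hi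
  obtain ⟨w, hw, hesc⟩ := exists_escape M hlow v S hsmall
  obtain ⟨k, hk⟩ := hX.exists_factor_in_progression w a.length b.length
    (List.length_pos_iff.2 hb)
  set c := (List.replicate k b).flatten with hc
  have hcK : K.evalFrom (S, q) c = (S, q) :=
    K.evalFrom_of_pow (by rw [hK, h₂.1, h₂.2]) (mem_kstar_singleton_iff.2 ⟨k, rfl⟩)
  rw [hK, Prod.mk.injEq] at hcK
  have hmem : a ++ c ++ v ∈ 𝒰.I := by
    rw [← hN, DFA.mem_accepts, DFA.eval, DFA.evalFrom_of_append, DFA.evalFrom_of_append, h₁.2,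
      hcK.2]
    have : a ++ b ++ v ∈ N.accepts := by rw [hN, ← hi']; exact i.2
    rwa [DFA.mem_accepts, DFA.eval, DFA.evalFrom_of_append, DFA.evalFrom_of_append,
      h₁.2, h₂.2] at this
  have hXcov := Set.mem_iInter.1 hcov ⟨_, hmem⟩
  rw [← coverSet_start 𝒰 M hM] at hXcov
  obtain ⟨s, hs, h⟩ :=
    exists_mem_reach_shift M (M.start, ∅) (a ++ c) v {(M.start, ∅)} X _ rfl hXcov
  change s ∈ R.evalFrom _ _ at hs
  rw [DFA.evalFrom_of_append, h₁.1, hcK.1] at hs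
  refine hesc s hs _ ?_ h
  rw [← factor_eq_factor_shift, ← hw]
  convert hk using 2
  simp [hc]

/-! ### Sequences that avoid a word -/

theorem measurable_shift (n : ℕ) : Measurable (shift n) :=
  measurable_pi_lambda _ fun _ => measurable_pi_apply _

theorem measure_preimage_shift (n : ℕ) {B : Set Seq} (hB : MeasurableSet B) :
    cantorMeasure (shift n ⁻¹' B) = cantorMeasure B := by
  induction n with
  | zero => congr 1; ext Z; simp
  | succ n ih =>
    have h (x : Bool) : cons x ⁻¹' (shift (n + 1) ⁻¹' B) = shift n ⁻¹' B := by
      ext Z; simp [shift_succ_cons]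
    rw [cantorMeasure_eq (measurable_shift _ hB), h, h, ih, ← two_mul, ← mul_assoc,
      ENNReal.inv_mul_cancel two_ne_zero ENNReal.ofNat_ne_top, one_mul]

/-- Not starting with `w` costs a constant factor in measure. -/
theorem exists_contraction (w : Word) :
    ∃ r : ℝ≥0∞, r < 1 ∧ ∀ A B : Set Seq, MeasurableSet A → MeasurableSet B →
      (∀ Z ∈ A, factor Z 0 w.length ≠ w ∧ shift w.length Z ∈ B) →
        cantorMeasure A ≤ r * cantorMeasure B := by
  induction w with
  | nil =>
    refine ⟨0, one_pos, fun A B _ _ h => ?_⟩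
    have : A = ∅ := Set.eq_empty_of_forall_notMem fun Z hZ => (h Z hZ).1 rfl
    simp [this]
  | cons x w ih =>
    obtain ⟨r, hr, h⟩ := ih
    -- The half starting with `x` inherits the factor `r`; the other half is bounded trivially by
    -- `B`.
    refine ⟨2⁻¹ * (r + 1), ?_, fun A B hA hB hAB => ?_⟩
    · have h₁ : r + 1 < 2 := by
        rw [← one_add_one_eq_two]
        exact ENNReal.add_lt_add_right ENNReal.one_ne_top hr
      calc 2⁻¹ * (r + 1) < 2⁻¹ * 2 := (ENNReal.mul_lt_mul_iff_right (by simp) (by simp)).2 h₁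
        _ = 1 := ENNReal.inv_mul_cancel two_ne_zero ENNReal.ofNat_ne_top
    · have hx : cantorMeasure (cons x ⁻¹' A) ≤ r * cantorMeasure B := by
        refine h _ B (measurable_cons x hA) hB fun Z hZ => ?_
        have := hAB _ hZ
        rw [List.length_cons, factor_cons_succ, shift_succ_cons] at this
        exact ⟨fun hw => this.1 (by rw [hw]), this.2⟩
      have hy (y : Bool) : cantorMeasure (cons y ⁻¹' A) ≤ cantorMeasure B := by
        rw [← measure_preimage_shift w.length hB]
        refine measure_mono fun Z hZ => ?_
        have := (hAB _ hZ).2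
        rwa [List.length_cons, shift_succ_cons] at this
      have hsum : cantorMeasure (cons false ⁻¹' A) + cantorMeasure (cons true ⁻¹' A) ≤
          (r + 1) * cantorMeasure B := by
        rw [add_mul, one_mul]
        cases x
        · exact add_le_add hx (hy true)
        · rw [add_comm]
          exact add_le_add hx (hy false)
      rw [cantorMeasure_eq hA, mul_assoc]
      exact mul_le_mul_right hsum _

/-- The sequences in which `w` occupies none of the first `m` consecutive blocks. -/
def blockAvoiding (w : Word) (m : ℕ) : Set Seq :=
  {Z | ∀ j < m, factor Z (j * w.length) w.length ≠ w}

theorem measurableSet_blockAvoiding (w : Word) (m : ℕ) : MeasurableSet (blockAvoiding w m) := by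
  have : blockAvoiding w m =
      ⋂ j ∈ Set.Iio m, shift (j * w.length) ⁻¹' {Z | factor Z 0 w.length ≠ w} := by
    ext Z
    simp only [blockAvoiding, factor_eq_factor_shift Z, Set.mem_ofPred_eq, Set.mem_iInter,
      Set.mem_Iio, Set.mem_preimage]
  rw [this]
  exact .biInter (Set.to_countable _) fun j _ =>
    measurable_shift _ (measurableSet_factor (fun u => u ≠ w) _)

theorem exists_measure_blockAvoiding_le (w : Word) :
    ∃ r : ℝ≥0∞, r < 1 ∧ ∀ m, cantorMeasure (blockAvoiding w m) ≤ r ^ m := by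
  obtain ⟨r, hr, h⟩ := exists_contraction w
  refine ⟨r, hr, fun m => ?_⟩
  induction m with
  | zero => simpa using prob_le_one
  | succ m ih =>
    rw [pow_succ']
    refine (h _ _ (measurableSet_blockAvoiding w _) (measurableSet_blockAvoiding w m)
      fun Z hZ => ⟨by simpa using hZ 0 m.succ_pos, fun j hj => ?_⟩).trans (by gcongr)
    have := hZ (j + 1) (by lia)
    rwa [factor_eq_factor_shift, shift_shift, Nat.add_comm, ← Nat.succ_mul,
      ← factor_eq_factor_shift]

/-! ### The test of the words that avoid a word -/

/-- The language of all words in which `w` does not occur. -/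
def avoiding {α : Type*} (w : List α) : Language α := {x | ¬ w <:+: x}

/-- A state is the set of suffixes of `w` still to be read by the occurrences begun so far; `[]`
records a completed occurrence and persists. -/
theorem isRegular_avoiding {α : Type*} (w : List α) : (avoiding w).IsRegular := by
  classical
  have hfin : Finite {t // t ∈ w.tails} := w.tails.finite_toSet
  rw [Language.isRegular_iff]
  let D : DFA α (Set {t // t ∈ w.tails}) :=
    { step := fun P a => {t | (∃ s ∈ P, s.1 = a :: t.1) ∨ t.1 = w ∨ (t.1 = [] ∧ ∃ s ∈ P, s.1 = [])}
      start := {t | t.1 = w}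
      accept := {P | ¬ ∃ s ∈ P, s.1 = []} }
  have hw : w ∈ w.tails := by simp
  have key : ∀ (z : List α) (P : Set {t // t ∈ w.tails}), ⟨w, hw⟩ ∈ P →
      ((∃ s ∈ D.evalFrom P z, s.1 = []) ↔ (∃ s ∈ P, s.1 <+: z) ∨ w <:+: z) := by
    intro z
    induction z with
    | nil =>
      intro P hP
      simp only [DFA.evalFrom_nil, List.prefix_nil, List.infix_nil]
      exact ⟨Or.inl, fun h => h.elim id fun h => ⟨_, hP, h⟩⟩
    | cons a z ih =>
      intro P hP
      rw [DFA.evalFrom_cons, ih _ (Or.inr (Or.inl rfl)), List.infix_cons_iff]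
      constructor
      · rintro (⟨t, ⟨s, hs, hst⟩ | ht | ⟨-, s, hs, hs'⟩, htz⟩ | h)
        · exact Or.inl ⟨s, hs, by rw [hst]; exact List.cons_prefix_cons.2 ⟨rfl, htz⟩⟩
        · exact Or.inr (Or.inr (ht ▸ htz.isInfix))
        · exact Or.inl ⟨s, hs, by rw [hs']; exact List.nil_prefix⟩
        · exact Or.inr (Or.inr h)
      · have hstep : ∀ s ∈ P, s.1 <+: a :: z → ∃ t ∈ D.step P a, t.1 <+: z := by
          rintro s hs h
          rcases List.prefix_cons_iff.1 h with h | ⟨t, ht, htz⟩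
          · exact ⟨⟨[], by simp⟩, Or.inr (Or.inr ⟨rfl, s, hs, h⟩), List.nil_prefix⟩
          · have hs' := s.2
            rw [List.mem_tails, ht] at hs'
            exact ⟨⟨t, (List.mem_tails _ _).2 ((List.suffix_cons a t).trans hs')⟩,
              Or.inl ⟨s, hs, ht⟩, htz⟩
        rintro (⟨s, hs, h⟩ | h | h)
        · exact Or.inl (hstep s hs h)
        · exact Or.inl (hstep _ hP h)
        · exact Or.inr h
  refine ⟨_, Fintype.ofFinite _, D, ?_⟩
  ext z
  change ¬ (∃ s ∈ D.evalFrom D.start z, s.1 = []) ↔ ¬ w <:+: z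
  rw [key z D.start rfl, not_iff_not]
  refine ⟨?_, Or.inr⟩
  rintro (⟨s, hs, h⟩ | h)
  · exact (show s.1 = w from hs) ▸ h.isInfix
  · exact h

theorem map_fst_convolution (x y : Word) :
    (convolution x y).map Prod.fst =
      x.map some ++ List.replicate (y.length - x.length) none := by
  apply List.ext_getElem
  · simp [convolution]; lia
  · intro n h₁ h₂
    by_cases hn : n < x.length
    · simp [convolution, hn]
    · simp [convolution, hn, List.getElem_append]

theorem map_some_infix_iff {w x : Word} : w.map some <:+: x.map some ↔ w <:+: x := by
  refine ⟨fun h => ?_, fun h => h.map some⟩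
  simpa [List.filterMap_map] using h.filterMap id

theorem none_infix_iff (x : Word) (n : ℕ) :
    [none] <:+: x.map some ++ List.replicate n none ↔ n ≠ 0 := by
  constructor
  · rintro h rfl
    simpa using h.subset (List.mem_singleton_self none)
  · intro hn
    obtain ⟨n, rfl⟩ := Nat.exists_eq_succ_of_ne_zero hn
    exact ⟨x.map some, List.replicate n none, by simp [List.replicate_succ]⟩

/-- Both conditions are pattern avoidance on the first track of the convolution: the length
condition says that no blank occurs there. -/
theorem isAutomaticRel_avoiding (w : Word) :
    IsAutomaticRel fun x i => i.length ≤ x.length ∧ ¬ w <:+: x := by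
  obtain ⟨σ, hσ, D, hD⟩ := (isRegular_avoiding [(none : Option Bool)]).inf
    (isRegular_avoiding (w.map some))
  refine ⟨σ, hσ, D.comap Prod.fst, fun x y => ?_⟩
  rw [DFA.accepts_comap, hD]
  change ¬ [none] <:+: List.map Prod.fst _ ∧ ¬ w.map some <:+: List.map Prod.fst _ ↔ _
  rw [map_fst_convolution, none_infix_iff, not_not, Nat.sub_eq_zero_iff_le]
  refine and_congr_right fun h => ?_
  rw [Nat.sub_eq_zero_of_le h, List.replicate_zero, List.append_nil, map_some_infix_iff]

/-- The family of the languages of all long enough words that avoid `w`. -/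
def avoidingFamily (w : Word) : AutomaticFamily where
  I := Set.univ
  U i := {x | i.1.length ≤ x.length ∧ ¬ w <:+: x}
  regular := ⟨Unit, inferInstance, ⟨fun _ _ => (), (), Set.univ⟩, rfl⟩
  automatic := by
    obtain ⟨σ, hσ, M, hM⟩ := isAutomaticRel_avoiding w
    exact ⟨σ, hσ, M, fun x y => (hM x y).trans ⟨fun h => ⟨trivial, h⟩, fun ⟨_, h⟩ => h⟩⟩

theorem factor_infix {Z : Seq} {m l n : ℕ} (h : m + l ≤ n) : factor Z m l <:+: factor Z 0 n := by
  obtain ⟨k, rfl⟩ := Nat.exists_eq_add_of_le h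
  exact ⟨factor Z 0 m, factor Z (m + l) k, by simp only [factor_add, Nat.zero_add]⟩

theorem exists_factor_eq_of_infix {Z : Seq} {w : Word} {n : ℕ} (h : w <:+: factor Z 0 n) :
    ∃ m, factor Z m w.length = w := by
  obtain ⟨s, t, h⟩ := h
  have hn : n = s.length + w.length + t.length := by
    simpa [Nat.add_assoc] using (congrArg List.length h).symm
  rw [hn, factor_add, factor_add] at h
  have h₁ := List.append_inj_left h (by simp)
  exact ⟨_, by simpa using (List.append_inj_right h₁ (by simp)).symm⟩

theorem extensions_avoidingFamily_subset {w : Word} (i : {i // i ∈ (avoidingFamily w).I}) :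
    extensions ((avoidingFamily w).U i) ⊆ blockAvoiding w (i.1.length / w.length) := by
  rintro Z ⟨x, ⟨hx, hwx⟩, hxZ⟩ j hj hfac
  refine hwx ?_
  have hxZ' : factor Z 0 x.length = x := hxZ
  have := factor_infix (Z := Z) (m := j * w.length) (l := w.length) (n := x.length)
    (hx.trans' ?_)
  · rwa [hfac, hxZ'] at this
  rw [← Nat.succ_mul]
  exact (Nat.mul_le_mul_right _ hj).trans (Nat.div_mul_le_self _ _)

theorem avoidingFamily_isART {w : Word} (hw : w ≠ []) : (avoidingFamily w).IsART := by
  obtain ⟨r, hr, h⟩ := exists_measure_blockAvoiding_le w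
  -- Makes the cofinite filter nontrivial, so that the limit is the limit inferior.
  have : Infinite {i : Word // i ∈ (avoidingFamily w).I} :=
    Set.infinite_coe_iff.2 Set.infinite_univ
  refine Tendsto.liminf_eq (tendsto_of_tendsto_of_tendsto_of_le_of_le tendsto_const_nhds
    (((ENNReal.tendsto_pow_atTop_nhds_zero_of_lt_one hr).comp
      (Nat.tendsto_div_const_atTop (List.length_pos_iff.2 hw).ne')).comp
      (tendsto_length_cofinite (avoidingFamily w).I)) (fun _ => zero_le) fun i => ?_)
  exact (measure_mono (extensions_avoidingFamily_subset i)).trans (h _)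

theorem IsAutomaticRandom.isDisjunctive {X : Seq} (hX : IsAutomaticRandom X) :
    IsDisjunctive X := by
  intro w
  by_contra! h
  refine hX (avoidingFamily w) (avoidingFamily_isART ?_) (Set.mem_iInter.2 fun i => ?_)
  · rintro rfl
    exact h 0 rfl
  · refine ⟨factor X 0 i.1.length, ⟨by simp, fun hw => ?_⟩, by simp [IsPrefixOf]⟩
    obtain ⟨m, hm⟩ := exists_factor_eq_of_infix hw
    exact h m hm

end AutomaticRandomness

theorem theorem9 (X : AutomaticRandomness.Seq) :
    AutomaticRandomness.IsAutomaticRandom X ↔ AutomaticRandomness.IsDisjunctive X :=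
  ⟨fun h => h.isDisjunctive, fun h => h.isAutomaticRandom⟩
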